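/- **Setting.** Let $N,M,K\ge 0$ be integers, $\epsilon_0\in\mathbb R$, $A_1,\dots,A_N,B_1,\dots,B_M\in\mathbb R$, $\Delta\in\mathbb C$ and $\Delta_{-K},\dots,\Delta_K\in\mathbb C$. Let $\omega>0$ and let $\omega_\epsilon=p\,\omega$, $\omega_\Delta=q\,\omega$ with positive integers $p,q$ (for instance $\omega=\gcd(\omega_\epsilon,\omega_\Delta)$ for commensurate frequencies). Consider, for $t\in\mathbb R$, $$H(t)=\frac12\begin{pmatrix}\epsilon(t)&\Delta(t)\\ \overline{\Delta(t)}&-\epsilon(t)\end{pmatrix},$$ $$\epsilon(t)=\epsilon_0+\sum_{n=1}^N A_n\cos(n\omega_\epsilon t)+\sum_{m=1}^M B_m\sin(m\omega_\epsilon t),\qquad \Delta(t)=\Delta+\sum_{k=-K}^K\Delta_k e^{ik\omega_\Delta t}.$$ The time-ordered exponential generated by $H$ is the $2\times2$ matrix function $V(t,s)$ with $\partial_tV(t,s)=-iH(t)V(t,s)$ and $V(s,s)=1$. Let $\varphi(t)=\epsilon_0t+\sum_{n=1}^N\frac{A_n}{n\omega_\epsilon}\sin(n\omega_\epsilon t)-\sum_{m=1}^M\frac{B_m}{m\omega_\epsilon}\cos(m\omega_\epsilon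 t)$, $U_0(t)=\mathrm{diag}(e^{-i\varphi(t)/2},e^{i\varphi(t)/2})$, and let $H_{\rm rot}=U_0^\dagger HU_0-iU_0^\dagger\,\partial_tU_0$ be the Hamiltonian in the rotating frame. *Generalized Bessel functions.* For $l\in\mathbb Z$ put $$\mathcal J_l=\frac1{2\pi}\int_{-\pi}^{\pi}\exp\Big(i\sum_{n=1}^N a_n\sin n\theta+\sum_{m=1}^M b_m\cos m\theta-il\theta\Big)d\theta,\qquad a_n=\frac{A_n}{n\omega_\epsilon},\quad b_m=\frac{-iB_m}{m\omega_\epsilon},$$ and let the weighted generalized Bessel functions be $$\mathcal J_l^\Delta=\sum_{\substack{-K\le k\le K\\ p\,\mid\, l-qk}}\frac{\Delta_k+\delta_{k0}\Delta}{2}\;\mathcal J_{(l-qk)/p}.$$ *Divided differences.* For $x_0,\dots,x_n\in\mathbb R$ let $e^{i[x_n,\dots,x_0]t}$ be the divided difference of $z\mapsto e^{izt}$ at $x_0,\dots,x_n$, that is, $\sum_{k=0}^n e^{ix_kt}\big/\prod_{j\ne k}(x_k-x_j)$ for distinct arguments, extended continuously to coinciding arguments. **Theorem.** For all $t\in\mathbb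 R$, $$H_{\rm rot}(t)=\begin{pmatrix}0&\sum_{l\in\mathbb Z}\mathcal J_l^\Delta e^{i(\epsilon_0+l\omega)t}\\ \sum_{l\in\mathbb Z}\overline{\mathcal J_l^\Delta}e^{-i(\epsilon_0+l\omega)t}&0\end{pmatrix}.$$ The time-ordered exponentials $V$ of $H$ and $U$ of $H_{\rm rot}$ exist and are unique, $V(t,s)=U_0(t)\,U(t,s)\,U_0(s)^\dagger$, and $U(t,s)$ is unitary. Write $M_j=\omega\sum_{i\le j}m_i$ and $N_j=\omega\sum_{i\le j}n_i$ for integers $m_i,n_i$. For all $t,s\in\mathbb R$, $$U_{11}(t,s)=1+\sum_{k\ge1}\ \sum_{m\in\mathbb Z^k,\,n\in\mathbb Z^k}\ \prod_{i=1}^k\overline{\mathcal J_{n_i}^\Delta}\prod_{i=1}^k\mathcal J_{m_i}^\Delta\; e^{i(M_k-N_k)s}\,e^{i[M_k-N_k,\ \epsilon_0+M_k-N_{k-1},\ M_{k-1}-N_{k-1},\ \dots,\ M_1-N_1,\ \epsilon_0+M_1,\ 0](t-s)},$$ $$U_{12}(t,s)=-\sum_{k\ge0}\ \sum_{m\in\mathbb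 Z^{k+1},\,n\in\mathbb Z^k}\ \prod_{i=1}^k\overline{\mathcal J_{n_i}^\Delta}\prod_{i=1}^{k+1}\mathcal J_{m_i}^\Delta\; e^{i(\epsilon_0+M_{k+1}-N_k)s}\,e^{i[\epsilon_0+M_{k+1}-N_k,\ M_k-N_k,\ \dots,\ M_1-N_1,\ \epsilon_0+M_1,\ 0](t-s)},$$ with $U_{22}=\overline{U_{11}}$ and $U_{21}=-\overline{U_{12}}$. Both series converge unconditionally as sums over all $(k,m,n)$, and uniformly on $\{|t-s|\le T\}$ for every $T$. Consequently the transition probability is exactly $$|V_{12}(t,s)|^2=|U_{12}(t,s)|^2=\Big|\sum_{k\ge0}\ \sum_{m\in\mathbb Z^{k+1},\,n\in\mathbb Z^k}\ \prod_{i=1}^k\overline{\mathcal J_{n_i}^\Delta}\prod_{i=1}^{k+1}\mathcal J_{m_i}^\Delta\; e^{i(\epsilon_0+M_{k+1}-N_k)s}\,e^{i[\epsilon_0+M_{k+1}-N_k,\,\dots,\,\epsilon_0+M_1,\,0](t-s)}\Big|^2 .$$ -/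

import Mathlib

open scoped Matrix ComplexConjugate

noncomputable section

namespace TwoLevel

/-- Parameters of the drive. `ε₀`, `A n`, `B m` : static longitudinal bias and longitudinal Fourier
coefficients (used for `1 ≤ n ≤ N`, `1 ≤ m ≤ M`); `Δ₀`, `Δ k` : static transverse term and transverse
Fourier coefficients (used for `-K ≤ k ≤ K`); `ωε`, `ωΔ` : the two fundamental frequencies. -/
structure Drive where
  N : ℕ
  M : ℕ
  K : ℕ
  ε₀ : ℝ
  A : ℕ → ℝ
  B : ℕ → ℝ
  Δ₀ : ℂ
  Δ : ℤ → ℂ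
  ωε : ℝ
  ωΔ : ℝ

namespace Drive

variable (D : Drive)

/-- Longitudinal drive `ε(t)`. -/
def eps (t : ℝ) : ℝ :=
  D.ε₀ + ∑ n ∈ Finset.Icc 1 D.N, D.A n * Real.cos (n * D.ωε * t)
    + ∑ m ∈ Finset.Icc 1 D.M, D.B m * Real.sin (m * D.ωε * t)

/-- Transverse drive `Δ(t)`. -/
def delta (t : ℝ) : ℂ :=
  D.Δ₀ + ∑ k ∈ Finset.Icc (-(D.K : ℤ)) D.K, D.Δ k * Complex.exp (Complex.I * k * D.ωΔ * t)

/-- The Hamiltonian `H(t)`. -/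
def hamiltonian (t : ℝ) : Matrix (Fin 2) (Fin 2) ℂ :=
  (1 / 2 : ℂ) • !![(D.eps t : ℂ), D.delta t; conj (D.delta t), -(D.eps t : ℂ)]

/-- The antiderivative of `ε(t)` with mean-free oscillating part. -/
def phase (t : ℝ) : ℝ :=
  D.ε₀ * t + ∑ n ∈ Finset.Icc 1 D.N, D.A n / (n * D.ωε) * Real.sin (n * D.ωε * t)
    - ∑ m ∈ Finset.Icc 1 D.M, D.B m / (m * D.ωε) * Real.cos (m * D.ωε * t)

/-- The rotating-frame unitary `U₀(t) = exp (-(i/2) phase(t) σ_z)`. -/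
def frame (t : ℝ) : Matrix (Fin 2) (Fin 2) ℂ :=
  !![Complex.exp (-(Complex.I / 2) * D.phase t), 0; 0, Complex.exp ((Complex.I / 2) * D.phase t)]

/-- The rotating-frame Hamiltonian `U₀† H U₀ - i U₀† ∂ₜU₀`. -/
def rotHamiltonian (t : ℝ) : Matrix (Fin 2) (Fin 2) ℂ :=
  (D.frame t)ᴴ * D.hamiltonian t * D.frame t
    - Complex.I • ((D.frame t)ᴴ * Matrix.of fun i j => deriv (fun τ => D.frame τ i j) t)

end Drive

/-- `U(t,s)` is the time-ordered exponential generated by `-i H(t)`: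
`∂ₜ U(t,s) = -i H(t) U(t,s)` and `U(s,s) = 1`. -/
def IsTimeOrderedExp (H : ℝ → Matrix (Fin 2) (Fin 2) ℂ)
    (U : ℝ → ℝ → Matrix (Fin 2) (Fin 2) ℂ) : Prop :=
  (∀ s, U s s = 1) ∧
    ∀ s t i j, HasDerivAt (fun τ => U τ s i j) (((-Complex.I) • (H t * U t s)) i j) t

/-- The generalized Bessel function of order `l` in `N` sine-type arguments `a 1, …, a N` and `M`
cosine-type arguments `b 1, …, b M`: the `l`-th Fourier coefficient of
`θ ↦ exp (i ∑ₙ aₙ sin (n θ) + ∑ₘ bₘ cos (m θ))`. -/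
def gbf (N M : ℕ) (a b : ℕ → ℂ) (l : ℤ) : ℂ :=
  (1 / (2 * Real.pi) : ℂ) * ∫ θ in (-Real.pi)..Real.pi,
    Complex.exp (Complex.I * ∑ n ∈ Finset.Icc 1 N, a n * Real.sin (n * θ)
      + ∑ m ∈ Finset.Icc 1 M, b m * Real.cos (m * θ) - Complex.I * l * θ)

namespace Drive

variable (D : Drive)

/-- The generalized Bessel function at the modulation indices of the longitudinal drive. -/
def bessel (l : ℤ) : ℂ :=
  gbf D.N D.M (fun n => ((D.A n / (n * D.ωε) : ℝ) : ℂ))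
    (fun m => -Complex.I * ((D.B m / (m * D.ωε) : ℝ) : ℂ)) l

/-- The weighted generalized Bessel function `𝒥_l^Δ` relative to the common frequency `ω`, where
`ωε = p ω` and `ωΔ = q ω`. The static term `Δ₀` counts towards the `k = 0` harmonic.
For `p = q = 1` the summand is `(Δ_k / 2) 𝒥_{l-k}`. -/
def wbessel (p q : ℕ) (l : ℤ) : ℂ :=
  ∑ k ∈ Finset.Icc (-(D.K : ℤ)) D.K, (D.Δ k + if k = 0 then D.Δ₀ else 0) / 2 *
    if (p : ℤ) ∣ l - q * k then D.bessel ((l - q * k) / p) else 0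

end Drive

/-- The function `z ↦ f[x 0, …, x (n-1), z]`. `dslope g a z` is `(g z - g a) / (z - a)` for `z ≠ a`
and `g' a` for `z = a`, so that repeated arguments are covered. -/
def divDiffFun (f : ℂ → ℂ) (x : ℕ → ℂ) : ℕ → ℂ → ℂ
  | 0 => f
  | n + 1 => dslope (divDiffFun f x n) (x n)

/-- The divided difference `f[x 0, …, x n]`. -/
def divDiff (f : ℂ → ℂ) (x : ℕ → ℂ) (n : ℕ) : ℂ := divDiffFun f x n (x n)

/-- Away from the nodes, and for distinct nodes, `divDiffFun` is given by partial fractions. -/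
theorem divDiffFun_eq_sum (f : ℂ → ℂ) (x : ℕ → ℂ) (n : ℕ)
    (hx : ∀ j < n, ∀ k < n, j ≠ k → x j ≠ x k) (z : ℂ) (hz : ∀ j < n, z ≠ x j) :
    divDiffFun f x n z = f z / ∏ j ∈ Finset.range n, (z - x j)
      + ∑ k ∈ Finset.range n, f (x k) /
          ((x k - z) * ∏ j ∈ (Finset.range n).erase k, (x k - x j)) := by
  induction n generalizing z with
  | zero => simp [divDiffFun]
  | succ n ih =>
    have hx' : ∀ j < n, ∀ k < n, j ≠ k → x j ≠ x k := fun j hj k hk =>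
      hx j (by omega) k (by omega)
    have hzn : z - x n ≠ 0 := sub_ne_zero.2 (hz n (by omega))
    have e : divDiffFun f x (n + 1) z
        = (divDiffFun f x n z - divDiffFun f x n (x n)) / (z - x n) := by
      simp only [divDiffFun]
      rw [dslope_of_ne _ (hz n (by omega)), slope_def_field]
    rw [e, ih hx' z (fun j hj => hz j (by omega)),
      ih hx' (x n) (fun j hj => hx n (by omega) j (by omega) (by omega)),
      Finset.sum_range_succ, Finset.prod_range_succ, Finset.range_add_one,
      Finset.erase_insert (by simp)]
    have key : ∀ k ∈ Finset.range n,
        f (x k) / ((x k - z) * ∏ j ∈ (insert n (Finset.range n)).erase k, (x k - x j))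
          = (f (x k) / ((x k - z) * ∏ j ∈ (Finset.range n).erase k, (x k - x j))
            - f (x k) / ((x k - x n) * ∏ j ∈ (Finset.range n).erase k, (x k - x j)))
              / (z - x n) := by
      intro k hk
      have hk' : k < n := Finset.mem_range.1 hk
      have h1 : x k - z ≠ 0 := sub_ne_zero.2 (hz k (by omega)).symm
      have h2 : x k - x n ≠ 0 := sub_ne_zero.2 (hx k (by omega) n (by omega) (by omega))
      have h3 : ∏ j ∈ (Finset.range n).erase k, (x k - x j) ≠ 0 := by
        refine Finset.prod_ne_zero_iff.2 fun j hj => ?_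
        have hj' := Finset.mem_erase.1 hj
        exact sub_ne_zero.2 (hx k (by omega) j
          (by have := Finset.mem_range.1 hj'.2; omega) hj'.1.symm)
      rw [Finset.erase_insert_of_ne (by omega), Finset.prod_insert (by simp)]
      field_simp
      ring
    rw [Finset.sum_congr rfl key, ← Finset.sum_div, Finset.sum_sub_distrib]
    have h4 : ∏ j ∈ Finset.range n, (z - x j) ≠ 0 :=
      Finset.prod_ne_zero_iff.2 fun j hj =>
        sub_ne_zero.2 (hz j (by have := Finset.mem_range.1 hj; omega))
    have h5 : ∏ j ∈ Finset.range n, (x n - x j) ≠ 0 :=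
      Finset.prod_ne_zero_iff.2 fun j hj => by
        have := Finset.mem_range.1 hj
        exact sub_ne_zero.2 (hx n (by omega) j (by omega) (by omega))
    have h6 : x n - z ≠ 0 := sub_ne_zero.2 (hz n (by omega)).symm
    generalize ∏ j ∈ Finset.range n, (z - x j) = P at *
    generalize ∏ j ∈ Finset.range n, (x n - x j) = Q at *
    rw [show x n - z = -(z - x n) by ring]
    field_simp
    ring

/-- For distinct nodes the divided difference is `∑ₖ f(xₖ) / ∏_{j ≠ k} (xₖ - xⱼ)`. -/
theorem divDiff_eq_sum (f : ℂ → ℂ) (x : ℕ → ℂ) (n : ℕ)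
    (hx : ∀ j ≤ n, ∀ k ≤ n, j ≠ k → x j ≠ x k) :
    divDiff f x n = ∑ k ∈ Finset.range (n + 1), f (x k) /
      ∏ j ∈ (Finset.range (n + 1)).erase k, (x k - x j) := by
  rw [divDiff, divDiffFun_eq_sum f x n (fun j hj k hk => hx j hj.le k hk.le) (x n)
    (fun j hj => hx n le_rfl j hj.le hj.ne'), Finset.sum_range_succ, add_comm]
  congr 1
  · refine Finset.sum_congr rfl fun k hk => ?_
    have hk' : k < n := Finset.mem_range.1 hk
    rw [Finset.range_add_one, Finset.erase_insert_of_ne (by omega),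
      Finset.prod_insert (by simp)]
  · rw [Finset.range_add_one, Finset.erase_insert (by simp)]

/-- The exponential divided difference `e^{i [x 0, …, x n] t}`. -/
def expDivDiff (x : ℕ → ℝ) (n : ℕ) (t : ℝ) : ℂ :=
  divDiff (fun z => Complex.exp (Complex.I * z * t)) (fun j => (x j : ℂ)) n

/-- The sum of the first `j` entries of a tuple. -/
def partialSum {k : ℕ} (m : Fin k → ℤ) (j : ℕ) : ℤ :=
  ∑ i : Fin k, if (i : ℕ) < j then m i else 0

/-- The arguments of the divided differences. With `M_j = ω (m₁ + ⋯ + m_j)` and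
`N_j = ω (n₁ + ⋯ + n_j)`, node `2 j` is `M_j - N_j` and node `2 j + 1` is `ε₀ + M_{j+1} - N_j`;
the sequence starts `0, ε₀ + M₁, M₁ - N₁, ε₀ + M₂ - N₁, M₂ - N₂, …`. -/
def node (ε₀ ω : ℝ) {k l : ℕ} (m : Fin k → ℤ) (n : Fin l → ℤ) (r : ℕ) : ℝ :=
  (if Odd r then ε₀ else 0)
    + ω * ((partialSum m ((r + 1) / 2) : ℝ) - (partialSum n (r / 2) : ℝ))

namespace Drive

variable (D : Drive)

/-- A term of the series: `∏ conj 𝒥_{n_i} ∏ 𝒥_{m_i} e^{i x_r s} e^{i [x_r, …, x_1, x_0] (t - s)}`, where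
`r` is the total number of indices and `x_0, …, x_r` are the nodes. -/
def term (ω : ℝ) (p q : ℕ) {k l : ℕ} (m : Fin k → ℤ) (n : Fin l → ℤ) (t s : ℝ) : ℂ :=
  (∏ i, conj (D.wbessel p q (n i))) * (∏ i, D.wbessel p q (m i)) *
    Complex.exp (Complex.I * node D.ε₀ ω m n (k + l) * s) *
    expDivDiff (node D.ε₀ ω m n) (k + l) (t - s)

/-- Index set of the series for `U₁₁`: `k + 1` indices `m` and `k + 1` indices `n`, `k ≥ 0`. -/
abbrev Index11 : Type := Σ k : ℕ, (Fin (k + 1) → ℤ) × (Fin (k + 1) → ℤ)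

/-- Index set of the series for `U₁₂`: `k + 1` indices `m` and `k` indices `n`, `k ≥ 0`. -/
abbrev Index12 : Type := Σ k : ℕ, (Fin (k + 1) → ℤ) × (Fin k → ℤ)

/-- Terms of the series for `U₁₁ - 1`. -/
def term11 (ω : ℝ) (p q : ℕ) (i : Index11) (t s : ℝ) : ℂ := D.term ω p q i.2.1 i.2.2 t s

/-- Terms of the series for `-U₁₂`. -/
def term12 (ω : ℝ) (p q : ℕ) (i : Index12) (t s : ℝ) : ℂ := D.term ω p q i.2.1 i.2.2 t s

end Drive

end TwoLevel

end

/-! Both series are checked by differentiating in the initial time `s`, not in `t`. In a term, the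
factor `e^{i x_r s}` multiplies a divided difference at time `t - s`. The product rule cancels the
two contributions of `x_r`, and what is left is `-i` times the divided difference with the node
`x_r` removed (`hasDerivAt_cexp_mul_expDivDiff`). Since `x_r - x_{r-1}` is `ε₀ + a ω` or `-(ε₀ + b
ω)`, with `a` or `b` the last index, the derivative is one Fourier mode of the coupling (or of its
conjugate) times the term without that index. Summing over all indices, the odd series has
derivative `-i` times the coupling times the even series, and the even series has derivative `-i`
times the conjugate coupling times the odd one. This is the backward equation `∂ₛU = i U H_rot`,
with `U(t,t) = 1`.

For Hermitian `H`, the backward equation makes `U(t,τ) U(s,τ)†` constant in `τ`, so `U(t,s) =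
U(s,t)†`, and taking adjoints gives the forward equation. Existence thus comes from the series
themselves; uniqueness and unitarity come from the constancy of `U† U'`.

Convergence has two sources. The Bessel functions are Fourier coefficients of a smooth function,
hence absolutely summable, and a divided difference of order `r` is at most `|t|^r / r!`. With `C =
∑ ‖𝒥_l^Δ‖`, each series is therefore dominated by part of the exponential series of `C T`. -/

noncomputable section

namespace TwoLevel

/-! ### Fourier series of twice differentiable periodic functions. -/

/-- The `l`-th Fourier coefficient of a `2π`-periodic function. -/
def circleCoeff (F : ℝ → ℂ) (l : ℤ) : ℂ :=
  (1 / (2 * Real.pi) : ℂ) * ∫ θ in (-Real.pi)..Real.pi, F θ * Complex.exp (-(Complex.I * l * θ))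

theorem periodic_deriv {F : ℝ → ℂ} {c : ℝ} (h : Function.Periodic F c) :
    Function.Periodic (deriv F) c := by
  intro x
  rw [← deriv_comp_add_const]
  congr 1
  exact funext h

theorem hasDerivAt_cexp_neg (l : ℤ) (θ : ℝ) :
    HasDerivAt (fun θ : ℝ => Complex.exp (-(Complex.I * l * θ)))
      (Complex.exp (-(Complex.I * l * θ)) * (-(Complex.I * l))) θ := by
  have h : HasDerivAt (fun θ : ℝ => -(Complex.I * l * (θ : ℂ))) (-(Complex.I * l)) θ := by
    simpa using (((hasDerivAt_id (θ : ℂ)).const_mul (Complex.I * l)).neg).comp_ofReal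
  exact h.cexp

theorem cexp_neg_pi (l : ℤ) :
    Complex.exp (-(Complex.I * l * (-Real.pi : ℝ))) = Complex.exp (-(Complex.I * l * Real.pi)) := by
  rw [Complex.exp_eq_exp_iff_exists_int]
  exact ⟨l, by push_cast; ring⟩

/-- Integration by parts; periodicity cancels the boundary terms. -/
theorem circleCoeff_deriv {F : ℝ → ℂ} (hF : ContDiff ℝ 1 F)
    (hper : Function.Periodic F (2 * Real.pi)) (l : ℤ) :
    circleCoeff (deriv F) l = Complex.I * l * circleCoeff F l := by
  have hd : ∀ θ, HasDerivAt F (deriv F θ) θ := fun θ =>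
    (hF.differentiable one_ne_zero θ).hasDerivAt
  have hc : Continuous (deriv F) := hF.continuous_deriv le_rfl
  have hb : F (-Real.pi) = F Real.pi := by
    have := hper (-Real.pi)
    rw [← this]; congr 1; ring
  have key := intervalIntegral.integral_mul_deriv_eq_deriv_mul (a := -Real.pi) (b := Real.pi)
    (fun θ _ => hasDerivAt_cexp_neg l θ) (fun θ _ => hd θ)
    (Continuous.intervalIntegrable (by fun_prop) _ _) (hc.intervalIntegrable _ _)
  rw [hb, cexp_neg_pi, sub_self, zero_sub] at key
  unfold circleCoeff
  have e1 : ∫ θ in (-Real.pi)..Real.pi, deriv F θ * Complex.exp (-(Complex.I * l * θ))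
      = ∫ θ in (-Real.pi)..Real.pi, Complex.exp (-(Complex.I * l * θ)) * deriv F θ := by
    congr 1; ext θ; ring
  have e2 : ∫ θ in (-Real.pi)..Real.pi,
        Complex.exp (-(Complex.I * l * θ)) * (-(Complex.I * l)) * F θ
      = -(Complex.I * l) * ∫ θ in (-Real.pi)..Real.pi, F θ * Complex.exp (-(Complex.I * l * θ)) := by
    rw [← intervalIntegral.integral_const_mul]
    congr 1; ext θ; ring
  rw [e1, key, e2]
  ring

theorem norm_circleCoeff_le {F : ℝ → ℂ} {C : ℝ} (hC : ∀ θ ∈ Set.Icc (-Real.pi) Real.pi, ‖F θ‖ ≤ C)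
    (l : ℤ) : ‖circleCoeff F l‖ ≤ C := by
  have hpi := Real.pi_pos
  have h : ‖∫ θ in (-Real.pi)..Real.pi, F θ * Complex.exp (-(Complex.I * l * θ))‖
      ≤ C * |Real.pi - -Real.pi| := by
    refine intervalIntegral.norm_integral_le_of_norm_le_const fun θ hθ => ?_
    rw [Set.uIoc_of_le (by linarith)] at hθ
    have : ‖Complex.exp (-(Complex.I * l * θ))‖ = 1 := by
      rw [show -(Complex.I * l * θ) = ((-(l * θ) : ℝ) : ℂ) * Complex.I by push_cast; ring]
      exact Complex.norm_exp_ofReal_mul_I _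
    rw [norm_mul, this, mul_one]
    exact hC θ ⟨hθ.1.le, hθ.2⟩
  unfold circleCoeff
  rw [norm_mul, show (1 / (2 * Real.pi) : ℂ) = ((1 / (2 * Real.pi) : ℝ) : ℂ) by push_cast; rfl,
    Complex.norm_real, Real.norm_of_nonneg (by positivity)]
  calc _ ≤ 1 / (2 * Real.pi) * (C * |Real.pi - -Real.pi|) := by gcongr
    _ = C := by
      rw [abs_of_pos (by linarith)]
      field_simp
      ring

/-- Two integrations by parts bound the coefficients by a multiple of `1 / l²`. -/
theorem summable_norm_circleCoeff {F : ℝ → ℂ} (hF : ContDiff ℝ 2 F)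
    (hper : Function.Periodic F (2 * Real.pi)) : Summable fun l => ‖circleCoeff F l‖ := by
  have h1 : ContDiff ℝ 1 (deriv F) := by
    have : ContDiff ℝ (1 + 1) F := by simpa [one_add_one_eq_two] using hF
    exact (contDiff_succ_iff_deriv.1 this).2.2
  obtain ⟨C, hC⟩ := isCompact_Icc.exists_bound_of_continuousOn
    (h1.continuous_deriv le_rfl).continuousOn (s := Set.Icc (-Real.pi) Real.pi)
  have hs : Summable fun l : ℤ => C * (1 / (l : ℝ) ^ 2) :=
    (Real.summable_one_div_int_pow.2 one_lt_two).mul_left C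
  refine Summable.of_norm_bounded_eventually hs ?_
  -- The bound fails at `l = 0`, where `1 / l ^ 2` takes the value `0`.
  filter_upwards [(Set.finite_singleton (0 : ℤ)).compl_mem_cofinite] with l hl
  have hl : (l : ℝ) ≠ 0 := by simpa using hl
  have := norm_circleCoeff_le hC l
  rw [circleCoeff_deriv h1 (periodic_deriv hper),
    circleCoeff_deriv (hF.of_le one_le_two) hper, ← mul_assoc, norm_mul,
    show Complex.I * l * (Complex.I * l) = ((-(l : ℝ) ^ 2 : ℝ) : ℂ) by
      push_cast; linear_combination (l : ℂ) ^ 2 * Complex.I_sq,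
    Complex.norm_real, norm_neg, Real.norm_of_nonneg (by positivity)] at this
  rw [norm_norm, mul_one_div, le_div_iff₀ (by positivity), mul_comm]
  exact this

theorem hasSum_circleCoeff {F : ℝ → ℂ} (hF : ContDiff ℝ 2 F)
    (hper : Function.Periodic F (2 * Real.pi)) (θ : ℝ) :
    HasSum (fun l : ℤ => circleCoeff F l * Complex.exp (Complex.I * l * θ)) (F θ) := by
  have : Fact (0 < 2 * Real.pi) := ⟨Real.two_pi_pos⟩
  have hpi : (Real.pi : ℂ) ≠ 0 := Complex.ofReal_ne_zero.2 Real.pi_ne_zero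
  let G : C(AddCircle (2 * Real.pi), ℂ) :=
    ⟨hper.lift, continuous_coinduced_dom.mpr hF.continuous⟩
  have hG : ∀ x : ℝ, G x = F x := fun x => hper.lift_coe x
  have hc : ∀ l, fourierCoeff G l = circleCoeff F l := by
    intro l
    rw [fourierCoeff_eq_intervalIntegral _ l (-Real.pi),
      show -Real.pi + 2 * Real.pi = Real.pi by ring, circleCoeff, Complex.real_smul]
    push_cast
    congr 1
    refine intervalIntegral.integral_congr fun x _ => ?_
    simp only [hG, fourier_coe_apply, smul_eq_mul]
    rw [mul_comm]
    congr 2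
    push_cast
    field_simp
  have := has_pointwise_sum_fourier_series_of_summable (f := G)
    ((summable_norm_circleCoeff hF hper).of_norm.congr fun l => (hc l).symm) (θ : AddCircle _)
  rw [hG] at this
  refine this.congr_fun fun l => ?_
  rw [hc, fourier_coe_apply, smul_eq_mul]
  congr 2
  push_cast
  field_simp

/-! ### Bessel expansions of the phase factor and of the coupling. -/

namespace Drive

variable (D : Drive)

/-- The `2π`-periodic part of `exp (i phase)` as a function of the angle `ωε t`. -/
def phaseFactor (θ : ℝ) : ℂ :=
  Complex.exp (Complex.I * ∑ n ∈ Finset.Icc 1 D.N,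
      ((D.A n / (n * D.ωε) : ℝ) : ℂ) * Real.sin (n * θ)
    + ∑ m ∈ Finset.Icc 1 D.M, -Complex.I * ((D.B m / (m * D.ωε) : ℝ) : ℂ) * Real.cos (m * θ))

theorem contDiff_phaseFactor : ContDiff ℝ 2 D.phaseFactor := by
  unfold phaseFactor
  have h1 : ∀ n : ℕ, ContDiff ℝ 2 fun θ : ℝ => ((Real.sin (n * θ) : ℝ) : ℂ) := fun n =>
    Complex.ofRealCLM.contDiff.comp (by fun_prop : ContDiff ℝ 2 fun θ : ℝ => Real.sin (n * θ))
  have h2 : ∀ n : ℕ, ContDiff ℝ 2 fun θ : ℝ => ((Real.cos (n * θ) : ℝ) : ℂ) := fun n =>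
    Complex.ofRealCLM.contDiff.comp (by fun_prop : ContDiff ℝ 2 fun θ : ℝ => Real.cos (n * θ))
  refine ContDiff.cexp (ContDiff.add (contDiff_const.mul ?_) ?_)
  · exact ContDiff.sum fun n _ => contDiff_const.mul (h1 n)
  · exact ContDiff.sum fun n _ => contDiff_const.mul (h2 n)

theorem periodic_phaseFactor : Function.Periodic D.phaseFactor (2 * Real.pi) := by
  intro θ
  have h1 : ∀ n : ℕ, Real.sin (n * (θ + 2 * Real.pi)) = Real.sin (n * θ) := fun n => by
    rw [mul_add, Real.sin_add_nat_mul_two_pi]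
  have h2 : ∀ n : ℕ, Real.cos (n * (θ + 2 * Real.pi)) = Real.cos (n * θ) := fun n => by
    rw [mul_add, Real.cos_add_nat_mul_two_pi]
  simp only [phaseFactor, h1, h2]

theorem bessel_eq_circleCoeff (l : ℤ) : D.bessel l = circleCoeff D.phaseFactor l := by
  unfold bessel gbf circleCoeff phaseFactor
  congr 2
  ext θ
  rw [← Complex.exp_add]
  rfl

theorem exp_phase (t : ℝ) :
    Complex.exp (Complex.I * D.phase t)
      = Complex.exp (Complex.I * D.ε₀ * t) * D.phaseFactor (D.ωε * t) := by
  rw [phaseFactor, ← Complex.exp_add]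
  congr 1
  simp only [phase]
  push_cast
  simp only [← mul_assoc, mul_sub, mul_add, Finset.mul_sum, neg_mul, Finset.sum_neg_distrib]
  ring

theorem summable_norm_bessel : Summable fun l => ‖D.bessel l‖ := by
  simpa only [bessel_eq_circleCoeff] using
    summable_norm_circleCoeff D.contDiff_phaseFactor D.periodic_phaseFactor

theorem hasSum_bessel (θ : ℝ) :
    HasSum (fun l : ℤ => D.bessel l * Complex.exp (Complex.I * l * θ)) (D.phaseFactor θ) := by
  simpa only [bessel_eq_circleCoeff] using
    hasSum_circleCoeff D.contDiff_phaseFactor D.periodic_phaseFactor θ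

/-- Reindexing by `l = a + p j`: the divisibility condition selects the range of this injection, and
the other terms vanish. -/
theorem hasSum_dvd_iff {p : ℕ} (hp : 0 < p) (a : ℤ) (f : ℤ → ℤ → ℂ) (s : ℂ) :
    HasSum (fun l : ℤ => if (p : ℤ) ∣ l - a then f ((l - a) / p) l else 0) s
      ↔ HasSum (fun j : ℤ => f j (a + p * j)) s := by
  have hp' : (p : ℤ) ≠ 0 := by exact_mod_cast hp.ne'
  have hinj : Function.Injective fun j : ℤ => a + p * j := fun i j h => by
    simpa [hp.ne'] using h
  rw [← hinj.hasSum_iff]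
  · simp [Function.comp_def, Int.mul_ediv_cancel_left _ hp']
  · intro l hl
    rw [if_neg]
    rintro ⟨j, hj⟩
    exact hl ⟨j, by simp only; omega⟩

theorem summable_norm_wbessel {p : ℕ} (hp : 0 < p) (q : ℕ) :
    Summable fun l => ‖D.wbessel p q l‖ := by
  refine Summable.norm ?_
  refine summable_sum fun k _ => Summable.mul_left _ ?_
  exact ((hasSum_dvd_iff hp (q * k) (fun j _ => D.bessel j) _).2
    D.summable_norm_bessel.of_norm.hasSum).summable

/-- The coupling in the rotating frame. -/
def coupling (t : ℝ) : ℂ := D.delta t / 2 * Complex.exp (Complex.I * D.phase t)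

/-- The harmonic `k` of the transverse drive times the Bessel mode `j` oscillates at `ε₀ + (q k + p
j) ω`; collecting `l = q k + p j` for each `k` produces the weighted coefficients. -/
theorem hasSum_coupling {ω : ℝ} {p q : ℕ} (hp : 0 < p) (hε : D.ωε = p * ω) (hΔ : D.ωΔ = q * ω)
    (t : ℝ) :
    HasSum (fun l : ℤ => D.wbessel p q l * Complex.exp (Complex.I * (D.ε₀ + l * ω) * t))
      (D.coupling t) := by
  have hd : D.delta t / 2 = ∑ k ∈ Finset.Icc (-(D.K : ℤ)) D.K,
      (D.Δ k + if k = 0 then D.Δ₀ else 0) / 2 * Complex.exp (Complex.I * k * D.ωΔ * t) := by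
    have : ∀ k : ℤ, (D.Δ k + if k = 0 then D.Δ₀ else 0) / 2 * Complex.exp (Complex.I * k * D.ωΔ * t)
        = D.Δ k * Complex.exp (Complex.I * k * D.ωΔ * t) / 2 + if k = 0 then D.Δ₀ / 2 else 0 := by
      intro k
      split_ifs with h
      · subst h; simp; ring
      · ring
    simp only [this, Finset.sum_add_distrib, ← Finset.sum_div, Finset.sum_ite_eq', delta]
    rw [if_pos (by simp)]
    ring
  rw [coupling, hd, exp_phase, Finset.sum_mul]
  have : ∀ l : ℤ, D.wbessel p q l * Complex.exp (Complex.I * (D.ε₀ + l * ω) * t)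
      = ∑ k ∈ Finset.Icc (-(D.K : ℤ)) D.K, (D.Δ k + if k = 0 then D.Δ₀ else 0) / 2 *
        if (p : ℤ) ∣ l - q * k then D.bessel ((l - q * k) / p) *
          Complex.exp (Complex.I * (D.ε₀ + l * ω) * t) else 0 := by
    intro l
    rw [wbessel, Finset.sum_mul]
    refine Finset.sum_congr rfl fun k _ => ?_
    rw [mul_assoc]; congr 1
    split_ifs <;> simp
  simp only [this]
  refine hasSum_sum fun k _ => ?_
  rw [mul_assoc]
  refine HasSum.mul_left _ ?_
  rw [hasSum_dvd_iff hp (q * k) (fun j l => D.bessel j *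
    Complex.exp (Complex.I * (D.ε₀ + l * ω) * t))]
  rw [← mul_assoc, ← Complex.exp_add]
  refine ((D.hasSum_bessel (D.ωε * t)).mul_left _).congr_fun fun j => ?_
  rw [mul_left_comm, ← Complex.exp_add]
  congr 2
  rw [hε, hΔ]
  push_cast
  ring

/-! ### The rotating frame. -/

theorem hasDerivAt_phase (hω : D.ωε ≠ 0) (t : ℝ) : HasDerivAt D.phase (D.eps t) t := by
  have hl : ∀ n : ℕ, HasDerivAt (fun t : ℝ => (n : ℝ) * D.ωε * t) (n * D.ωε) t := fun n => by
    simpa using (hasDerivAt_id t).const_mul ((n : ℝ) * D.ωε)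
  have h1 : HasDerivAt (fun t : ℝ => D.ε₀ * t) D.ε₀ t := by
    simpa using (hasDerivAt_id t).const_mul D.ε₀
  have h2 : HasDerivAt (fun t : ℝ => ∑ n ∈ Finset.Icc 1 D.N,
      D.A n / (n * D.ωε) * Real.sin (n * D.ωε * t))
      (∑ n ∈ Finset.Icc 1 D.N, D.A n * Real.cos (n * D.ωε * t)) t := by
    refine HasDerivAt.fun_sum fun n hn => ?_
    have hn : (n : ℝ) ≠ 0 := by have := (Finset.mem_Icc.1 hn).1; positivity
    refine ((hl n).sin.const_mul (D.A n / (n * D.ωε))).congr_deriv ?_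
    field_simp
  have h3 : HasDerivAt (fun t : ℝ => ∑ n ∈ Finset.Icc 1 D.M,
      D.B n / (n * D.ωε) * Real.cos (n * D.ωε * t))
      (-∑ n ∈ Finset.Icc 1 D.M, D.B n * Real.sin (n * D.ωε * t)) t := by
    rw [← Finset.sum_neg_distrib]
    refine HasDerivAt.fun_sum fun n hn => ?_
    have hn : (n : ℝ) ≠ 0 := by have := (Finset.mem_Icc.1 hn).1; positivity
    refine ((hl n).cos.const_mul (D.B n / (n * D.ωε))).congr_deriv ?_
    field_simp
  refine ((h1.add h2).sub h3).congr_deriv ?_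
  simp only [eps]
  ring

/-- The entrywise time derivative of `frame`. -/
def frameDeriv (t : ℝ) : Matrix (Fin 2) (Fin 2) ℂ :=
  !![-(Complex.I / 2) * D.eps t * Complex.exp (-(Complex.I / 2) * D.phase t), 0;
    0, (Complex.I / 2) * D.eps t * Complex.exp ((Complex.I / 2) * D.phase t)]

theorem hasDerivAt_frame (hω : D.ωε ≠ 0) (t : ℝ) (i j : Fin 2) :
    HasDerivAt (fun τ => D.frame τ i j) (D.frameDeriv t i j) t := by
  have h : ∀ c : ℂ, HasDerivAt (fun τ : ℝ => Complex.exp (c * D.phase τ))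
      (c * D.eps t * Complex.exp (c * D.phase t)) t := fun c => by
    rw [mul_comm (c * _)]
    exact ((D.hasDerivAt_phase hω t).ofReal_comp.const_mul c).cexp
  fin_cases i <;> fin_cases j
  · simpa [frame, frameDeriv] using h (-(Complex.I / 2))
  · simpa [frame, frameDeriv] using hasDerivAt_const t (0 : ℂ)
  · simpa [frame, frameDeriv] using hasDerivAt_const t (0 : ℂ)
  · simpa [frame, frameDeriv] using h (Complex.I / 2)

theorem conj_exp_phase (t : ℝ) (c : ℂ) :
    conj (Complex.exp (c * D.phase t)) = Complex.exp (conj c * D.phase t) := by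
  rw [← Complex.exp_conj, map_mul, Complex.conj_ofReal]

theorem frame_mem_unitaryGroup (t : ℝ) : D.frame t ∈ Matrix.unitaryGroup (Fin 2) ℂ := by
  rw [Matrix.mem_unitaryGroup_iff, Matrix.star_eq_conjTranspose]
  ext i j
  fin_cases i <;> fin_cases j <;>
    simp [frame, Matrix.mul_apply, ← Complex.exp_add, ← Complex.exp_conj, neg_div, map_ofNat]

/-- The diagonal cancels because the phase has derivative `ε(t)`; off the diagonal, the two half
phases combine into `exp (± i phase)`. -/
theorem rotHamiltonian_eq (hω : D.ωε ≠ 0) (t : ℝ) :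
    D.rotHamiltonian t = !![0, D.coupling t; conj (D.coupling t), 0] := by
  have hd : (Matrix.of fun i j => deriv (fun τ => D.frame τ i j) t) = D.frameDeriv t := by
    ext i j
    exact (D.hasDerivAt_frame hω t i j).deriv
  rw [rotHamiltonian, hd]
  have e2 : Complex.exp (Complex.I * D.phase t)
      = Complex.exp (Complex.I / 2 * D.phase t) * Complex.exp (Complex.I / 2 * D.phase t) := by
    rw [← Complex.exp_add]; congr 1; ring
  have e3 : conj (Complex.exp (Complex.I / 2 * D.phase t))
      = Complex.exp (-(Complex.I / 2 * D.phase t)) := by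
    rw [conj_exp_phase]; simp [neg_div, map_ofNat]
  have e4 : conj (Complex.exp (-(Complex.I / 2 * D.phase t)))
      = Complex.exp (Complex.I / 2 * D.phase t) := by
    rw [← e3, Complex.conj_conj]
  ext i j
  fin_cases i <;> fin_cases j
  all_goals simp [frame, frameDeriv, hamiltonian, coupling, Matrix.mul_apply, e2, e3, e4,
      Fin.sum_univ_two, map_ofNat, -mul_eq_zero]
  · linear_combination (D.eps t) / 2 * Complex.exp (Complex.I / 2 * D.phase t) *
      Complex.exp (-(Complex.I / 2 * D.phase t)) * Complex.I_sq
  · ring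
  · ring
  · linear_combination -(D.eps t) / 2 * Complex.exp (Complex.I / 2 * D.phase t) *
      Complex.exp (-(Complex.I / 2 * D.phase t)) * Complex.I_sq

end Drive

/-! ### Divided differences of the exponential as functions of time. -/

theorem differentiable_divDiffFun {f : ℂ → ℂ} (hf : Differentiable ℂ f) (x : ℕ → ℂ) (n : ℕ) :
    Differentiable ℂ (divDiffFun f x n) := by
  induction n with
  | zero => exact hf
  | succ n ih =>
    rw [← differentiableOn_univ] at ih ⊢
    exact (Complex.differentiableOn_dslope Filter.univ_mem).2 ih

theorem hasDerivAt_cexp_mul_ofReal (c : ℂ) (t : ℝ) :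
    HasDerivAt (fun t : ℝ => Complex.exp (c * t)) (c * Complex.exp (c * t)) t := by
  have h : HasDerivAt (fun t : ℝ => c * (t : ℂ)) c t := by
    simpa using ((hasDerivAt_id (t : ℂ)).const_mul c).comp_ofReal
  rw [mul_comm]
  exact h.cexp

/-- Variation of constants for a scalar linear equation. -/
theorem eq_integral_of_hasDerivAt {g r : ℝ → ℂ} {c : ℂ} (hr : Continuous r) (h0 : g 0 = 0)
    (hg : ∀ t, HasDerivAt g (c * g t + r t) t) (t : ℝ) :
    g t = Complex.exp (c * t) * ∫ τ in (0 : ℝ)..t, Complex.exp (-c * τ) * r τ := by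
  have hd : ∀ τ : ℝ, HasDerivAt (fun τ : ℝ => Complex.exp (-c * τ) * g τ)
      (Complex.exp (-c * τ) * r τ) τ := fun τ =>
    ((hasDerivAt_cexp_mul_ofReal (-c) τ).mul (hg τ)).congr_deriv (by ring)
  rw [intervalIntegral.integral_eq_sub_of_hasDerivAt (fun τ _ => hd τ)
    (Continuous.intervalIntegrable (by fun_prop) _ _), h0, mul_zero, sub_zero, ← mul_assoc,
    ← Complex.exp_add]
  simp

theorem hasDerivAt_integral_cexp {r : ℝ → ℂ} (hr : Continuous r) (c : ℂ) (t : ℝ) :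
    HasDerivAt (fun t : ℝ => Complex.exp (c * t) * ∫ τ in (0 : ℝ)..t, Complex.exp (-c * τ) * r τ)
      (c * (Complex.exp (c * t) * ∫ τ in (0 : ℝ)..t, Complex.exp (-c * τ) * r τ) + r t) t := by
  have hc : Continuous fun τ : ℝ => Complex.exp (-c * τ) * r τ := by fun_prop
  refine ((hasDerivAt_cexp_mul_ofReal c t).mul
    (hc.integral_hasStrictDerivAt 0 t).hasDerivAt).congr_deriv ?_
  rw [← mul_assoc (Complex.exp (c * t)), ← Complex.exp_add]
  simp
  ring

/-- The divided differences of `z ↦ exp (i z t)`, with a free last argument. -/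
def expDivDiffFun (x : ℕ → ℂ) (n : ℕ) (z : ℂ) (t : ℝ) : ℂ :=
  divDiffFun (fun z => Complex.exp (Complex.I * z * t)) x n z

theorem continuous_expDivDiffFun (x : ℕ → ℂ) (n : ℕ) (t : ℝ) :
    Continuous fun z => expDivDiffFun x n z t :=
  (differentiable_divDiffFun (by fun_prop) x n).continuous

theorem expDivDiffFun_succ_of_ne (x : ℕ → ℂ) (n : ℕ) {z : ℂ} (hz : z ≠ x n) (t : ℝ) :
    expDivDiffFun x (n + 1) z t
      = (expDivDiffFun x n z t - expDivDiffFun x n (x n) t) / (z - x n) := by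
  simp only [expDivDiffFun, divDiffFun]
  rw [dslope_of_ne _ hz, slope_def_field]

/-- In the difference quotient the inhomogeneity `r` cancels, since it does not depend on `z`. The
quotient solves `g' = i z g + i f(x n)` with `g 0 = 0`, where `f` is the previous divided
difference, and variation of constants applies. Both sides are continuous in `z`, so density of `z ≠
x n` covers a repeated node. -/
theorem expDivDiffFun_succ_eq_integral_aux (x : ℕ → ℂ) (n : ℕ) {r : ℝ → ℂ} {c : ℂ}
    (h0 : ∀ z, expDivDiffFun x n z 0 = c)
    (hd : ∀ z t, HasDerivAt (expDivDiffFun x n z) (Complex.I * z * expDivDiffFun x n z t + r t) t)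
    (z : ℂ) (t : ℝ) :
    expDivDiffFun x (n + 1) z t = Complex.exp (Complex.I * z * t) *
      ∫ τ in (0 : ℝ)..t, Complex.exp (-(Complex.I * z) * τ) *
        (Complex.I * expDivDiffFun x n (x n) τ) := by
  have hc : Continuous (expDivDiffFun x n (x n)) :=
    continuous_iff_continuousAt.2 fun t => (hd (x n) t).continuousAt
  have hne : ∀ z ∈ ({x n}ᶜ : Set ℂ), expDivDiffFun x (n + 1) z t =
      Complex.exp (Complex.I * z * t) *
      ∫ τ in (0 : ℝ)..t, Complex.exp (-(Complex.I * z) * τ) *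
        (Complex.I * expDivDiffFun x n (x n) τ) := by
    intro z hz
    have hz' : z - x n ≠ 0 := sub_ne_zero.2 hz
    refine eq_integral_of_hasDerivAt (by fun_prop) ?_ (fun t => ?_) t
    · rw [expDivDiffFun_succ_of_ne x n hz, h0, h0, sub_self, zero_div]
    · have hfun : expDivDiffFun x (n + 1) z = fun t =>
          (expDivDiffFun x n z t - expDivDiffFun x n (x n) t) / (z - x n) :=
        funext fun t => expDivDiffFun_succ_of_ne x n hz t
      rw [hfun]
      refine (((hd z t).sub (hd (x n) t)).div_const (z - x n)).congr_deriv ?_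
      field_simp
      ring
  have hcont : Continuous fun z : ℂ => Complex.exp (Complex.I * z * t) *
      ∫ τ in (0 : ℝ)..t, Complex.exp (-(Complex.I * z) * τ) *
        (Complex.I * expDivDiffFun x n (x n) τ) := by
    refine Continuous.mul (by fun_prop) ?_
    apply intervalIntegral.continuous_parametric_intervalIntegral_of_continuous'
    simp only [Function.uncurry_def]
    fun_prop
  exact congrFun ((continuous_expDivDiffFun x (n + 1) t).ext_on (dense_compl_singleton (x n))
    hcont hne) z

/-- The induction that supplies the hypotheses of the preceding lemma at every order: the
inhomogeneity and the value at time `0` are the same for all `z`. -/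
theorem exists_hasDerivAt_expDivDiffFun (x : ℕ → ℂ) (n : ℕ) : ∃ (r : ℝ → ℂ) (c : ℂ),
    (∀ z, expDivDiffFun x n z 0 = c) ∧
    ∀ z t, HasDerivAt (expDivDiffFun x n z) (Complex.I * z * expDivDiffFun x n z t + r t) t := by
  induction n with
  | zero =>
    refine ⟨0, 1, fun z => by simp [expDivDiffFun, divDiffFun], fun z t => ?_⟩
    exact (hasDerivAt_cexp_mul_ofReal (Complex.I * z) t).congr_deriv (by simp [expDivDiffFun, divDiffFun])
  | succ n ih =>
    obtain ⟨r, c, h0, hd⟩ := ih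
    have hc : Continuous (expDivDiffFun x n (x n)) :=
      continuous_iff_continuousAt.2 fun t => (hd (x n) t).continuousAt
    have h := expDivDiffFun_succ_eq_integral_aux x n h0 hd
    refine ⟨fun t => Complex.I * expDivDiffFun x n (x n) t, 0, fun z => by simp [h], fun z t => ?_⟩
    rw [funext (h z)]
    exact hasDerivAt_integral_cexp (by fun_prop) _ t

theorem continuous_expDivDiff (x : ℕ → ℝ) (n : ℕ) : Continuous (expDivDiff x n) := by
  obtain ⟨r, c, h0, hd⟩ := exists_hasDerivAt_expDivDiffFun (fun j => (x j : ℂ)) n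
  exact continuous_iff_continuousAt.2 fun t => (hd (x n) t).continuousAt

theorem expDivDiff_zero (x : ℕ → ℝ) (t : ℝ) :
    expDivDiff x 0 t = Complex.exp (Complex.I * x 0 * t) := rfl

theorem expDivDiff_succ (x : ℕ → ℝ) (n : ℕ) (t : ℝ) :
    expDivDiff x (n + 1) t = Complex.exp (Complex.I * x (n + 1) * t) *
      ∫ τ in (0 : ℝ)..t, Complex.exp (-(Complex.I * x (n + 1)) * τ) *
        (Complex.I * expDivDiff x n τ) := by
  obtain ⟨r, c, h0, hd⟩ := exists_hasDerivAt_expDivDiffFun (fun j => (x j : ℂ)) n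
  exact expDivDiffFun_succ_eq_integral_aux _ n h0 hd _ t

theorem expDivDiff_succ_at_zero (x : ℕ → ℝ) (n : ℕ) : expDivDiff x (n + 1) 0 = 0 := by
  simp [expDivDiff_succ]

theorem hasDerivAt_expDivDiff_succ (x : ℕ → ℝ) (n : ℕ) (t : ℝ) :
    HasDerivAt (expDivDiff x (n + 1))
      (Complex.I * x (n + 1) * expDivDiff x (n + 1) t + Complex.I * expDivDiff x n t) t := by
  have hc := continuous_expDivDiff x n
  rw [funext (expDivDiff_succ x n)]
  exact hasDerivAt_integral_cexp (by fun_prop) _ t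

theorem norm_cexp_I_mul_ofReal (x : ℝ) : ‖Complex.exp (Complex.I * x)‖ = 1 := by
  rw [mul_comm]; exact Complex.norm_exp_ofReal_mul_I x

theorem norm_expDivDiff_le (x : ℕ → ℝ) (n : ℕ) (t : ℝ) :
    ‖expDivDiff x n t‖ ≤ |t| ^ n / n.factorial := by
  have hexp : ∀ a b : ℝ, ‖Complex.exp (Complex.I * a * b)‖ = 1 := fun a b => by
    rw [mul_assoc, ← Complex.ofReal_mul]; exact norm_cexp_I_mul_ofReal _
  have hexp' : ∀ a b : ℝ, ‖Complex.exp (-(Complex.I * a) * b)‖ = 1 := fun a b => by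
    rw [neg_mul, Complex.exp_neg, norm_inv, hexp, inv_one]
  induction n generalizing t with
  | zero => simp [expDivDiff_zero, hexp]
  | succ n ih =>
    have hc := continuous_expDivDiff x n
    rw [expDivDiff_succ, norm_mul, hexp, one_mul]
    refine (intervalIntegral.norm_integral_le_integral_norm_uIoc).trans ?_
    have hle : ∀ τ : ℝ, ‖Complex.exp (-(Complex.I * x (n + 1)) * τ) *
        (Complex.I * expDivDiff x n τ)‖ ≤ |τ - 0| ^ n / n.factorial := fun τ => by
      rw [norm_mul, hexp', one_mul, norm_mul, Complex.norm_I, one_mul, sub_zero]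
      exact ih τ
    refine (MeasureTheory.integral_mono ?_ ?_ hle).trans ?_
    · exact (Continuous.integrableOn_uIoc (by fun_prop))
    · exact (Continuous.integrableOn_uIoc (by fun_prop))
    · rw [MeasureTheory.integral_div, integral_pow_abs_sub_uIoc, sub_zero, Nat.factorial_succ]
      push_cast
      rw [div_div]


theorem expDivDiff_congr {x y : ℕ → ℝ} {n : ℕ} (h : ∀ j ≤ n, x j = y j) :
    expDivDiff x n = expDivDiff y n := by
  induction n with
  | zero =>
    ext t
    rw [expDivDiff_zero, expDivDiff_zero, h 0 le_rfl]
  | succ n ih =>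
    ext t
    rw [expDivDiff_succ, expDivDiff_succ, h (n + 1) le_rfl, ih fun j hj => h j (by omega)]

/-- The contributions of the last node to the two factors have opposite signs and cancel. This is
why the terms carry the factor `e^{i x_r s}`. -/
theorem hasDerivAt_cexp_mul_expDivDiff (x : ℕ → ℝ) (n : ℕ) (t s : ℝ) :
    HasDerivAt (fun s : ℝ => Complex.exp (Complex.I * x (n + 1) * s) * expDivDiff x (n + 1) (t - s))
      (-Complex.I * (Complex.exp (Complex.I * x (n + 1) * s) * expDivDiff x n (t - s))) s := by
  have h1 : HasDerivAt (fun s : ℝ => t - s) (-1) s := by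
    simpa using (hasDerivAt_id s).const_sub t
  have h2 := (hasDerivAt_expDivDiff_succ x n (t - s)).scomp s h1
  refine ((hasDerivAt_cexp_mul_ofReal (Complex.I * x (n + 1)) s).mul h2).congr_deriv ?_
  simp only [Function.comp_apply, neg_smul, one_smul]
  ring

/-! ### Effect of an appended index on the nodes. -/

theorem partialSum_snoc_of_le {k : ℕ} (m : Fin k → ℤ) (a : ℤ) {j : ℕ} (hj : j ≤ k) :
    partialSum (Fin.snoc m a : Fin (k + 1) → ℤ) j = partialSum m j := by
  simp [partialSum, Fin.sum_univ_castSucc, hj]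

theorem partialSum_snoc_succ {k : ℕ} (m : Fin k → ℤ) (a : ℤ) :
    partialSum (Fin.snoc m a : Fin (k + 1) → ℤ) (k + 1) = partialSum m k + a := by
  simp only [partialSum, Fin.sum_univ_castSucc, Fin.snoc_castSucc, Fin.snoc_last, Fin.val_castSucc,
    Fin.val_last, lt_add_one, if_true, add_left_inj]
  refine Finset.sum_congr rfl fun i _ => ?_
  rw [if_pos (by omega), if_pos i.2]

/-- Node `r` sees only the first `(r + 1) / 2` entries of `m`, so a new entry is invisible up to `r
= 2 * k`. -/
theorem node_snoc_left_of_le (ε₀ ω : ℝ) {k l : ℕ} (m : Fin k → ℤ) (n : Fin l → ℤ) (a : ℤ) {r : ℕ}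
    (hr : r ≤ 2 * k) :
    node ε₀ ω (Fin.snoc m a : Fin (k + 1) → ℤ) n r = node ε₀ ω m n r := by
  rw [node, node, partialSum_snoc_of_le m a (by omega)]

theorem node_snoc_right_of_le (ε₀ ω : ℝ) {k l : ℕ} (m : Fin k → ℤ) (n : Fin l → ℤ) (b : ℤ) {r : ℕ}
    (hr : r ≤ 2 * l + 1) :
    node ε₀ ω m (Fin.snoc n b : Fin (l + 1) → ℤ) r = node ε₀ ω m n r := by
  rw [node, node, partialSum_snoc_of_le n b (by omega)]

theorem node_snoc_left_last (ε₀ ω : ℝ) {k : ℕ} (m n : Fin k → ℤ) (a : ℤ) :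
    node ε₀ ω (Fin.snoc m a : Fin (k + 1) → ℤ) n (k + k + 1)
      = node ε₀ ω m n (k + k) + (ε₀ + a * ω) := by
  have h1 : Odd (k + k + 1) := ⟨k, by omega⟩
  have h2 : ¬ Odd (k + k) := by rw [Nat.not_odd_iff_even]; exact ⟨k, rfl⟩
  rw [node, node, if_pos h1, if_neg h2, show (k + k + 1 + 1) / 2 = k + 1 by omega,
    show (k + k + 1) / 2 = k by omega, show (k + k) / 2 = k by omega, partialSum_snoc_succ]
  push_cast
  ring

theorem node_snoc_right_last (ε₀ ω : ℝ) {k : ℕ} (m : Fin (k + 1) → ℤ) (n : Fin k → ℤ) (b : ℤ) :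
    node ε₀ ω m (Fin.snoc n b : Fin (k + 1) → ℤ) (k + 1 + k + 1)
      = node ε₀ ω m n (k + 1 + k) - (ε₀ + b * ω) := by
  have h1 : Odd (k + 1 + k) := ⟨k, by omega⟩
  have h2 : ¬ Odd (k + 1 + k + 1) := by rw [Nat.not_odd_iff_even]; exact ⟨k + 1, by omega⟩
  rw [node, node, if_pos h1, if_neg h2, show (k + 1 + k + 1 + 1) / 2 = k + 1 by omega,
    show (k + 1 + k + 1) / 2 = k + 1 by omega, show (k + 1 + k) / 2 = k by omega,
    partialSum_snoc_succ]
  push_cast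
  ring

/-! ### Summation over tuples and the majorant of the series. -/

theorem hasSum_prod_fin {g : ℤ → ℝ} {C : ℝ} (hg : HasSum g C) (h0 : ∀ l, 0 ≤ g l) (k : ℕ) :
    HasSum (fun f : Fin k → ℤ => ∏ i, g (f i)) (C ^ k) := by
  induction k with
  | zero => simp
  | succ k ih =>
    rw [← (Fin.snocEquiv fun _ : Fin (k + 1) => ℤ).hasSum_iff, pow_succ']
    have hs := hg.summable.mul_of_nonneg ih.summable h0
      fun f => Finset.prod_nonneg fun i _ => h0 (f i)
    refine (hg.mul ih hs).congr_fun fun x => ?_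
    simp [Fin.snocEquiv, Fin.prod_univ_castSucc, mul_comm]

theorem summable_sigma_prod {g : ℤ → ℝ} {C : ℝ} (hg : HasSum g C) (h0 : ∀ l, 0 ≤ g l)
    (a b : ℕ → ℕ) {w : ℕ → ℝ} (hw0 : ∀ k, 0 ≤ w k)
    (hw : Summable fun k => C ^ b k * C ^ a k * w k) :
    Summable fun i : Σ k : ℕ, (Fin (a k) → ℤ) × (Fin (b k) → ℤ) =>
      (∏ j, g (i.2.2 j)) * (∏ j, g (i.2.1 j)) * w i.1 := by
  have hp : ∀ (k : ℕ) (f : Fin k → ℤ), 0 ≤ ∏ j, g (f j) := fun k f =>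
    Finset.prod_nonneg fun i _ => h0 (f i)
  have hsum : ∀ k, HasSum (fun x : (Fin (a k) → ℤ) × (Fin (b k) → ℤ) =>
      (∏ j, g (x.2 j)) * (∏ j, g (x.1 j)) * w k) (C ^ b k * C ^ a k * w k) := fun k => by
    have hs := (hasSum_prod_fin hg h0 (a k)).summable.mul_of_nonneg
      (hasSum_prod_fin hg h0 (b k)).summable (hp _) (hp _)
    rw [mul_comm (C ^ b k)]
    refine (((hasSum_prod_fin hg h0 (a k)).mul (hasSum_prod_fin hg h0 (b k)) hs).mul_right
      (w k)).congr_fun fun x => ?_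
    rw [mul_comm (∏ j, g (x.1 j))]
  rw [summable_sigma_of_nonneg fun i => mul_nonneg (mul_nonneg (hp _ _) (hp _ _)) (hw0 _)]
  exact ⟨fun k => (hsum k).summable, hw.congr fun k => ((hsum k).tsum_eq).symm⟩

namespace Drive

variable (D : Drive) (ω : ℝ) (p q : ℕ)

/-- The summable majorant of the series terms on `|t - s| ≤ T`. -/
def termBound (T : ℝ) {k l : ℕ} (m : Fin k → ℤ) (n : Fin l → ℤ) : ℝ :=
  (∏ i, ‖D.wbessel p q (n i)‖) * (∏ i, ‖D.wbessel p q (m i)‖) * (T ^ (k + l) / (k + l).factorial)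

theorem norm_term_le {T : ℝ} {k l : ℕ} (m : Fin k → ℤ) (n : Fin l → ℤ) {t s : ℝ}
    (h : |t - s| ≤ T) : ‖D.term ω p q m n t s‖ ≤ D.termBound p q T m n := by
  have hexp : ∀ a b : ℝ, ‖Complex.exp (Complex.I * a * b)‖ = 1 := fun a b => by
    rw [mul_assoc, ← Complex.ofReal_mul]; exact norm_cexp_I_mul_ofReal _
  rw [term, norm_mul, norm_mul, hexp, mul_one, norm_mul, norm_prod, norm_prod, termBound]
  simp only [Complex.norm_conj]
  gcongr
  refine (norm_expDivDiff_le _ _ _).trans ?_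
  gcongr

/-- For fixed `k` the sum over tuples is `(C T)^r / r!` with `r = a k + b k`; injectivity of `r`
makes this a subfamily of the exponential series. -/
theorem summable_termBound {p : ℕ} (hp : 0 < p) {T : ℝ} (hT : 0 ≤ T) (a b : ℕ → ℕ)
    (hab : Function.Injective fun k => a k + b k) :
    Summable fun i : Σ k : ℕ, (Fin (a k) → ℤ) × (Fin (b k) → ℤ) =>
      D.termBound p q T i.2.1 i.2.2 := by
  refine summable_sigma_prod (D.summable_norm_wbessel hp q).hasSum (fun l => norm_nonneg _) a b
    (w := fun k => T ^ (a k + b k) / (a k + b k).factorial) (fun k => by positivity) ?_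
  refine ((Real.summable_pow_div_factorial
    ((∑' l, ‖D.wbessel p q l‖) * T)).comp_injective hab).congr fun k => ?_
  simp only [Function.comp_apply, mul_pow, pow_add]
  ring

/-! ### Differentiation of the series in the initial time. -/

theorem hasDerivAt_term_snoc_left {k : ℕ} (m n : Fin k → ℤ) (a : ℤ) (t s : ℝ) :
    HasDerivAt (fun s => D.term ω p q (Fin.snoc m a : Fin (k + 1) → ℤ) n t s)
      (-Complex.I * ((D.wbessel p q a * Complex.exp (Complex.I * (D.ε₀ + a * ω) * s)) *
        D.term ω p q m n t s)) s := by
  unfold term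
  -- The order must have the form `n + 1` so that the last node can be split off.
  rw [show k + 1 + k = k + k + 1 by omega]
  simp only [mul_assoc _ (Complex.exp _) (expDivDiff _ _ _)]
  refine ((hasDerivAt_cexp_mul_expDivDiff _ (k + k) t s).const_mul _).congr_deriv ?_
  rw [node_snoc_left_last, expDivDiff_congr fun j hj =>
    node_snoc_left_of_le D.ε₀ ω m n a (by omega), Fin.prod_univ_castSucc]
  simp only [Fin.snoc_castSucc, Fin.snoc_last]
  have : Complex.exp (Complex.I * ((node D.ε₀ ω m n (k + k) + (D.ε₀ + a * ω) : ℝ) : ℂ) * s)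
      = Complex.exp (Complex.I * (D.ε₀ + a * ω) * s) *
        Complex.exp (Complex.I * node D.ε₀ ω m n (k + k) * s) := by
    rw [← Complex.exp_add]; congr 1; push_cast; ring
  rw [this]
  ring

theorem hasDerivAt_term_snoc_right {k : ℕ} (m : Fin (k + 1) → ℤ) (n : Fin k → ℤ) (b : ℤ)
    (t s : ℝ) :
    HasDerivAt (fun s => D.term ω p q m (Fin.snoc n b : Fin (k + 1) → ℤ) t s)
      (-Complex.I * ((conj (D.wbessel p q b) * Complex.exp (-Complex.I * (D.ε₀ + b * ω) * s)) *
        D.term ω p q m n t s)) s := by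
  unfold term
  rw [show k + 1 + (k + 1) = k + 1 + k + 1 by omega]
  simp only [mul_assoc _ (Complex.exp _) (expDivDiff _ _ _)]
  refine ((hasDerivAt_cexp_mul_expDivDiff _ (k + 1 + k) t s).const_mul _).congr_deriv ?_
  rw [node_snoc_right_last, expDivDiff_congr fun j hj =>
    node_snoc_right_of_le D.ε₀ ω m n b (by omega),
    Fin.prod_univ_castSucc (fun i => conj (D.wbessel p q ((Fin.snoc n b : Fin (k + 1) → ℤ) i)))]
  simp only [Fin.snoc_castSucc, Fin.snoc_last]
  have : Complex.exp (Complex.I * ((node D.ε₀ ω m n (k + 1 + k) - (D.ε₀ + b * ω) : ℝ) : ℂ) * s)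
      = Complex.exp (-Complex.I * (D.ε₀ + b * ω) * s) *
        Complex.exp (Complex.I * node D.ε₀ ω m n (k + 1 + k) * s) := by
    rw [← Complex.exp_add]; congr 1; push_cast; ring
  rw [this]
  ring

theorem term_self {k l : ℕ} (h : 0 < k + l) (m : Fin k → ℤ) (n : Fin l → ℤ) (t : ℝ) :
    D.term ω p q m n t t = 0 := by
  obtain ⟨r, hr⟩ := Nat.exists_eq_succ_of_ne_zero h.ne'
  rw [term, hr, sub_self, expDivDiff_succ_at_zero, mul_zero]

/-- The index set of the series for `U₁₁`, with the constant term. -/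
abbrev IndexEven : Type := Σ k : ℕ, (Fin k → ℤ) × (Fin k → ℤ)

/-- Appending the last entry of `n`. -/
def snocRight : ℤ × Index12 ≃ Index11 where
  toFun x := ⟨x.2.1, x.2.2.1, Fin.snoc x.2.2.2 x.1⟩
  invFun i := (i.2.2 (Fin.last _), ⟨i.1, i.2.1, Fin.init i.2.2⟩)
  left_inv x := by simp
  right_inv i := by simp

/-- Appending the last entry of `m`. -/
def snocLeft : ℤ × IndexEven ≃ Index12 where
  toFun x := ⟨x.2.1, Fin.snoc x.2.2.1 x.1, x.2.2.2⟩
  invFun i := (i.2.1 (Fin.last _), ⟨i.1, Fin.init i.2.1, i.2.2⟩)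
  left_inv x := by simp
  right_inv i := by simp

/-- Terms of the series for `U₁₁`. -/
def termEven (i : IndexEven) (t s : ℝ) : ℂ := D.term ω p q i.2.1 i.2.2 t s

variable {p}

theorem summable_bound11 (hp : 0 < p) {T : ℝ} (hT : 0 ≤ T) :
    Summable fun i : Index11 => D.termBound p q T i.2.1 i.2.2 :=
  D.summable_termBound q hp hT (fun k => k + 1) (fun k => k + 1) fun i j h => by
    simp only at h; omega

theorem summable_bound12 (hp : 0 < p) {T : ℝ} (hT : 0 ≤ T) :
    Summable fun i : Index12 => D.termBound p q T i.2.1 i.2.2 :=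
  D.summable_termBound q hp hT (fun k => k + 1) (fun k => k) fun i j h => by
    simp only at h; omega

theorem summable_boundEven (hp : 0 < p) {T : ℝ} (hT : 0 ≤ T) :
    Summable fun i : IndexEven => D.termBound p q T i.2.1 i.2.2 :=
  D.summable_termBound q hp hT (fun k => k) (fun k => k) fun i j h => by
    simp only at h; omega

theorem summable_norm_term11 (hp : 0 < p) (t s : ℝ) :
    Summable fun i => ‖D.term11 ω p q i t s‖ :=
  .of_nonneg_of_le (fun _ => norm_nonneg _) (fun i => D.norm_term_le ω p q i.2.1 i.2.2 le_rfl)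
    (D.summable_bound11 q hp (abs_nonneg (t - s)))

theorem summable_norm_term12 (hp : 0 < p) (t s : ℝ) :
    Summable fun i => ‖D.term12 ω p q i t s‖ :=
  .of_nonneg_of_le (fun _ => norm_nonneg _) (fun i => D.norm_term_le ω p q i.2.1 i.2.2 le_rfl)
    (D.summable_bound12 q hp (abs_nonneg (t - s)))

theorem summable_norm_termEven (hp : 0 < p) (t s : ℝ) :
    Summable fun i => ‖D.termEven ω p q i t s‖ :=
  .of_nonneg_of_le (fun _ => norm_nonneg _) (fun i => D.norm_term_le ω p q i.2.1 i.2.2 le_rfl)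
    (D.summable_boundEven q hp (abs_nonneg (t - s)))

theorem tsum_termEven (hp : 0 < p) (t s : ℝ) :
    ∑' i, D.termEven ω p q i t s = 1 + ∑' i, D.term11 ω p q i t s := by
  let i₀ : IndexEven := ⟨0, Fin.elim0, Fin.elim0⟩
  let emb : Index11 → IndexEven := fun i => ⟨i.1 + 1, i.2⟩
  have hinj : Function.Injective emb := by
    rintro ⟨k, x⟩ ⟨l, y⟩ h
    simp only [emb, Sigma.mk.injEq, add_left_inj] at h
    obtain ⟨rfl, h⟩ := h
    rw [eq_of_heq h]
  -- Zeroing the empty index, whose term is `1`, leaves a family supported on the range of `emb`.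
  have h1 := (D.summable_norm_termEven ω q hp t s).of_norm.hasSum.update i₀ 0
  rw [← hinj.hasSum_iff] at h1
  · have h2 : (Function.update (fun i => D.termEven ω p q i t s) i₀ 0) ∘ emb
        = fun i => D.term11 ω p q i t s := by
      ext i
      rw [Function.comp_apply, Function.update_of_ne]
      · rfl
      · intro h
        exact Nat.succ_ne_zero _ (congrArg Sigma.fst h)
    have h3 : D.termEven ω p q i₀ t s = 1 := by
      simp [i₀, termEven, term, expDivDiff_zero, node, partialSum]
    rw [h2, h3] at h1
    rw [h1.tsum_eq]
    ring
  · rintro ⟨k, x⟩ hk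
    cases k with
    | zero =>
      have : (⟨0, x⟩ : IndexEven) = i₀ := by
        simp only [i₀, Sigma.mk.injEq, heq_eq_eq, true_and]
        exact Subsingleton.elim _ _
      rw [this, Function.update_self]
    | succ k => exact absurd ⟨⟨k, x⟩, rfl⟩ hk

/-- Termwise differentiation on a ball about `t`, where all terms vanish and the sum trivially
converges. The summed derivative factors into a product of two absolutely convergent sums. -/
theorem hasDerivAt_tsum_of_bound {ι : Type*} {g : ι → ℝ → ℂ} {c : ℤ → ℝ → ℂ} {b : ℤ → ℝ}
    {B : ℝ → ι → ℝ} {G : ℤ × ι → ℝ → ℂ} {t : ℝ} (hG : ∀ x s, HasDerivAt (G x)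
      (-Complex.I * (c x.1 s * g x.2 s)) s)
    (hb : Summable b) (hcb : ∀ a s, ‖c a s‖ ≤ b a)
    (hB : ∀ T, 0 ≤ T → Summable (B T)) (hgB : ∀ T i s, |t - s| ≤ T → ‖g i s‖ ≤ B T i)
    (hG0 : ∀ x, G x t = 0) (s : ℝ) :
    HasDerivAt (fun s => ∑' x, G x s) (-Complex.I * ((∑' a, c a s) * ∑' i, g i s)) s := by
  -- The added `1` puts `s` inside the open ball.
  set T := |t - s| + 1 with hT
  have hT0 : 0 ≤ T := by positivity
  have hmem : ∀ y ∈ Metric.ball t T, |t - y| ≤ T := fun y hy => by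
    rw [Metric.mem_ball, dist_comm, Real.dist_eq] at hy
    exact hy.le
  have hb0 : ∀ a, 0 ≤ b a := fun a => (norm_nonneg _).trans (hcb a 0)
  have hB0 : ∀ i, 0 ≤ B T i := fun i => (norm_nonneg _).trans (hgB T i t (by simpa using hT0))
  have hle : ∀ x : ℤ × ι, ∀ y ∈ Metric.ball t T,
      ‖-Complex.I * (c x.1 y * g x.2 y)‖ ≤ b x.1 * B T x.2 := fun x y hy => by
    rw [norm_mul, norm_neg, Complex.norm_I, one_mul, norm_mul]
    exact mul_le_mul (hcb _ _) (hgB _ _ _ (hmem y hy)) (norm_nonneg _) (hb0 _)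
  have hs : s ∈ Metric.ball t T := by
    rw [Metric.mem_ball, dist_comm, Real.dist_eq]; linarith
  have h := hasDerivAt_tsum_of_isPreconnected (hb.mul_of_nonneg (hB T hT0) hb0 hB0)
    Metric.isOpen_ball (convex_ball t T).isPreconnected (fun x y _ => hG x y) hle
    (Metric.mem_ball_self (by positivity)) (by simpa only [hG0] using summable_zero) hs
  refine h.congr_deriv ?_
  rw [tsum_mul_left, tsum_mul_tsum_of_summable_norm]
  · exact .of_nonneg_of_le (fun _ => norm_nonneg _) (fun a => hcb a s) hb
  · exact .of_nonneg_of_le (fun _ => norm_nonneg _) (fun i => hgB T i s (hmem s hs)) (hB T hT0)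

/-- The series for `U₁₁`. -/
def evenSeries (ω : ℝ) (p q : ℕ) (t s : ℝ) : ℂ := 1 + ∑' i, D.term11 ω p q i t s

/-- The series for `-U₁₂`. -/
def oddSeries (ω : ℝ) (p q : ℕ) (t s : ℝ) : ℂ := ∑' i, D.term12 ω p q i t s

variable {ω q}

theorem norm_wbessel_mul_cexp (c : ℂ) (l : ℤ) (s : ℝ) :
    ‖c * Complex.exp (Complex.I * (D.ε₀ + l * ω) * s)‖ = ‖c‖ := by
  rw [norm_mul, show Complex.I * (D.ε₀ + l * ω) * s
    = Complex.I * (((D.ε₀ + l * ω) * s : ℝ) : ℂ) by push_cast; ring, norm_cexp_I_mul_ofReal, mul_one]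

theorem conj_mul_cexp (c : ℂ) (l : ℤ) (s : ℝ) :
    conj (c * Complex.exp (Complex.I * (D.ε₀ + l * ω) * s))
      = conj c * Complex.exp (-Complex.I * (D.ε₀ + l * ω) * s) := by
  simp [← Complex.exp_conj]

theorem hasSum_conj_coupling (hp : 0 < p) (hε : D.ωε = p * ω) (hΔ : D.ωΔ = q * ω) (t : ℝ) :
    HasSum (fun l : ℤ => conj (D.wbessel p q l) *
      Complex.exp (-Complex.I * (D.ε₀ + l * ω) * t)) (conj (D.coupling t)) := by
  simpa only [conj_mul_cexp] using Complex.hasSum_conj'.2 (D.hasSum_coupling hp hε hΔ t)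

theorem hasDerivAt_oddSeries (hp : 0 < p) (hε : D.ωε = p * ω) (hΔ : D.ωΔ = q * ω) (t s : ℝ) :
    HasDerivAt (D.oddSeries ω p q t)
      (-Complex.I * (D.coupling s * D.evenSeries ω p q t s)) s := by
  have hfun : D.oddSeries ω p q t = fun s => ∑' x : ℤ × IndexEven, D.term12 ω p q (snocLeft x) t s :=
    funext fun s => (snocLeft.tsum_eq fun i => D.term12 ω p q i t s).symm
  rw [hfun, evenSeries, ← D.tsum_termEven ω q hp, ← (D.hasSum_coupling hp hε hΔ s).tsum_eq]
  exact hasDerivAt_tsum_of_bound (t := t)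
    (c := fun l s => D.wbessel p q l * Complex.exp (Complex.I * (D.ε₀ + l * ω) * s))
    (g := fun i s => D.termEven ω p q i t s)
    (fun x s => D.hasDerivAt_term_snoc_left ω p q x.2.2.1 x.2.2.2 x.1 t s)
    (D.summable_norm_wbessel hp q) (fun a s => (D.norm_wbessel_mul_cexp _ a s).le)
    (fun T hT => D.summable_boundEven q hp hT)
    (fun T i s h => D.norm_term_le ω p q i.2.1 i.2.2 h)
    (fun x => D.term_self ω p q (by omega) _ _ t) s

theorem hasDerivAt_evenSeries (hp : 0 < p) (hε : D.ωε = p * ω) (hΔ : D.ωΔ = q * ω) (t s : ℝ) :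
    HasDerivAt (D.evenSeries ω p q t)
      (-Complex.I * (conj (D.coupling s) * D.oddSeries ω p q t s)) s := by
  have hfun : D.evenSeries ω p q t
      = fun s => 1 + ∑' x : ℤ × Index12, D.term11 ω p q (snocRight x) t s :=
    funext fun s => congrArg (1 + ·) (snocRight.tsum_eq fun i => D.term11 ω p q i t s).symm
  rw [hfun, oddSeries, ← (D.hasSum_conj_coupling hp hε hΔ s).tsum_eq]
  refine HasDerivAt.const_add 1 ?_
  exact hasDerivAt_tsum_of_bound (t := t)
    (c := fun l s => conj (D.wbessel p q l) * Complex.exp (-Complex.I * (D.ε₀ + l * ω) * s))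
    (g := fun i s => D.term12 ω p q i t s)
    (fun x s => D.hasDerivAt_term_snoc_right ω p q x.2.2.1 x.2.2.2 x.1 t s)
    (D.summable_norm_wbessel hp q)
    (fun a s => by
      rw [← conj_mul_cexp, Complex.norm_conj]
      exact (D.norm_wbessel_mul_cexp _ a s).le)
    (fun T hT => D.summable_bound12 q hp hT)
    (fun T i s h => D.norm_term_le ω p q i.2.1 i.2.2 h)
    (fun x => D.term_self ω p q (by omega) _ _ t) s

theorem evenSeries_self (t : ℝ) : D.evenSeries ω p q t t = 1 := by
  have : ∀ i, D.term11 ω p q i t t = 0 := fun i => D.term_self ω p q (by omega) _ _ t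
  simp [evenSeries, this]

theorem oddSeries_self (t : ℝ) : D.oddSeries ω p q t t = 0 := by
  have : ∀ i, D.term12 ω p q i t t = 0 := fun i => D.term_self ω p q (by omega) _ _ t
  simp [oddSeries, this]

end Drive

/-! ### Time-ordered exponentials of Hermitian generators. -/

/-- Entrywise differentiability of a matrix-valued function. -/
def HasEntryDerivAt (A : ℝ → Matrix (Fin 2) (Fin 2) ℂ) (A' : Matrix (Fin 2) (Fin 2) ℂ) (t : ℝ) :
    Prop :=
  ∀ i j, HasDerivAt (fun τ => A τ i j) (A' i j) t

namespace HasEntryDerivAt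

variable {A B : ℝ → Matrix (Fin 2) (Fin 2) ℂ} {A' B' : Matrix (Fin 2) (Fin 2) ℂ} {t : ℝ}

theorem mul (hA : HasEntryDerivAt A A' t) (hB : HasEntryDerivAt B B' t) :
    HasEntryDerivAt (fun τ => A τ * B τ) (A' * B t + A t * B') t := by
  intro i j
  simp only [Matrix.mul_apply, Matrix.add_apply, ← Finset.sum_add_distrib]
  exact HasDerivAt.fun_sum fun k _ => (hA i k).mul (hB k j)

theorem conjTranspose (hA : HasEntryDerivAt A A' t) :
    HasEntryDerivAt (fun τ => (A τ)ᴴ) A'ᴴ t := fun i j => (hA j i).star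

theorem congr_deriv (hA : HasEntryDerivAt A A' t) (h : A' = B') : HasEntryDerivAt A B' t := h ▸ hA

end HasEntryDerivAt

theorem hasEntryDerivAt_const (A : Matrix (Fin 2) (Fin 2) ℂ) (t : ℝ) :
    HasEntryDerivAt (fun _ => A) 0 t := fun _ _ => hasDerivAt_const _ _

theorem eq_of_hasEntryDerivAt_zero {A : ℝ → Matrix (Fin 2) (Fin 2) ℂ}
    (hA : ∀ t, HasEntryDerivAt A 0 t) (t s : ℝ) : A t = A s := by
  ext i j
  exact is_const_of_deriv_eq_zero (fun τ => (hA τ i j).differentiableAt)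
    (fun τ => (hA τ i j).deriv) t s

namespace IsTimeOrderedExp

variable {H : ℝ → Matrix (Fin 2) (Fin 2) ℂ} {U U' : ℝ → ℝ → Matrix (Fin 2) (Fin 2) ℂ}

theorem hasEntryDerivAt (hU : IsTimeOrderedExp H U) (t s : ℝ) :
    HasEntryDerivAt (fun τ => U τ s) ((-Complex.I) • (H t * U t s)) t := hU.2 s t

/-- The generators cancel in the derivative because `H` is Hermitian. Taking `U' = U` gives
unitarity; two solutions give uniqueness. -/
theorem conjTranspose_mul_eq_one (hH : ∀ t, (H t).IsHermitian) (hU : IsTimeOrderedExp H U)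
    (hU' : IsTimeOrderedExp H U') (t s : ℝ) : (U t s)ᴴ * U' t s = 1 := by
  have h : ∀ τ, HasEntryDerivAt (fun τ => (U τ s)ᴴ * U' τ s) 0 τ := fun τ => by
    refine ((hU.hasEntryDerivAt τ s).conjTranspose.mul (hU'.hasEntryDerivAt τ s)).congr_deriv ?_
    simp [Matrix.conjTranspose_smul, (hH τ).eq, Matrix.mul_assoc]
  have := eq_of_hasEntryDerivAt_zero h t s
  simpa [hU.1, hU'.1] using this

theorem mem_unitaryGroup (hH : ∀ t, (H t).IsHermitian) (hU : IsTimeOrderedExp H U) (t s : ℝ) :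
    U t s ∈ Matrix.unitaryGroup (Fin 2) ℂ :=
  Matrix.mem_unitaryGroup_iff'.2 (hU.conjTranspose_mul_eq_one hH hU t s)

protected theorem unique (hH : ∀ t, (H t).IsHermitian) (hU : IsTimeOrderedExp H U)
    (hU' : IsTimeOrderedExp H U') : U' = U := by
  ext1 t
  ext1 s
  have h1 : U t s * (U t s)ᴴ = 1 := mul_eq_one_comm.1 (hU.conjTranspose_mul_eq_one hH hU t s)
  have h2 := hU.conjTranspose_mul_eq_one hH hU' t s
  calc U' t s = U t s * (U t s)ᴴ * U' t s := by rw [h1, one_mul]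
    _ = U t s := by rw [Matrix.mul_assoc, h2, mul_one]

/-- The equation in the initial time determines the time-ordered exponential. -/
theorem of_hasEntryDerivAt_right (hH : ∀ t, (H t).IsHermitian) (h1 : ∀ t, U t t = 1)
    (hd : ∀ t s, HasEntryDerivAt (U t) (Complex.I • (U t s * H s)) s) : IsTimeOrderedExp H U := by
  -- The product `U t τ * (U s τ)ᴴ` is constant in `τ`; its values at `τ = s` and `τ = t` are the
  -- two sides.
  have hsymm : ∀ t s, U t s = (U s t)ᴴ := fun t s => by
    have h : ∀ τ, HasEntryDerivAt (fun τ => U t τ * (U s τ)ᴴ) 0 τ := fun τ => by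
      refine ((hd t τ).mul (hd s τ).conjTranspose).congr_deriv ?_
      simp [Matrix.conjTranspose_smul, (hH τ).eq, Matrix.mul_assoc]
    have := eq_of_hasEntryDerivAt_zero h s t
    simpa [h1] using this
  refine ⟨h1, fun s t => ?_⟩
  have h : (fun τ => U τ s) = fun τ => (U s τ)ᴴ := funext fun τ => hsymm τ s
  have h2 := (hd s t).conjTranspose
  rw [← h] at h2
  refine h2.congr_deriv ?_
  rw [hsymm t s]
  simp [Matrix.conjTranspose_smul, (hH t).eq]

end IsTimeOrderedExp

/-! ### Passage between the frames and the propagator. -/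

namespace Drive

variable (D : Drive)

theorem isHermitian_hamiltonian (t : ℝ) : (D.hamiltonian t).IsHermitian := by
  ext i j
  fin_cases i <;> fin_cases j <;> simp [hamiltonian]

theorem isHermitian_rotHamiltonian (hω : D.ωε ≠ 0) (t : ℝ) : (D.rotHamiltonian t).IsHermitian := by
  rw [D.rotHamiltonian_eq hω]
  ext i j
  fin_cases i <;> fin_cases j <;> simp

theorem frame_mul_conjTranspose (t : ℝ) : D.frame t * (D.frame t)ᴴ = 1 :=
  Matrix.mem_unitaryGroup_iff.1 (D.frame_mem_unitaryGroup t)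

theorem frame_mul_rotHamiltonian (hω : D.ωε ≠ 0) (t : ℝ) :
    D.frame t * D.rotHamiltonian t
      = D.hamiltonian t * D.frame t - Complex.I • D.frameDeriv t := by
  have hd : (Matrix.of fun i j => deriv (fun τ => D.frame τ i j) t) = D.frameDeriv t := by
    ext i j
    exact (D.hasDerivAt_frame hω t i j).deriv
  rw [rotHamiltonian, hd, mul_sub, Matrix.mul_smul, ← Matrix.mul_assoc, ← Matrix.mul_assoc,
    ← Matrix.mul_assoc, D.frame_mul_conjTranspose, one_mul, one_mul]

theorem isTimeOrderedExp_of_rot (hω : D.ωε ≠ 0) {U : ℝ → ℝ → Matrix (Fin 2) (Fin 2) ℂ}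
    (hU : IsTimeOrderedExp D.rotHamiltonian U) :
    IsTimeOrderedExp D.hamiltonian fun t s => D.frame t * U t s * (D.frame s)ᴴ := by
  refine ⟨fun s => ?_, fun s t => ?_⟩
  · beta_reduce
    rw [hU.1, mul_one, D.frame_mul_conjTranspose]
  · have hf : HasEntryDerivAt D.frame (D.frameDeriv t) t := D.hasDerivAt_frame hω t
    refine ((hf.mul (hU.hasEntryDerivAt t s)).mul
      (hasEntryDerivAt_const (D.frame s)ᴴ t)).congr_deriv ?_
    rw [mul_zero, add_zero, Matrix.mul_smul, ← Matrix.mul_assoc, D.frame_mul_rotHamiltonian hω,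
      sub_mul, smul_sub, Matrix.smul_mul, smul_smul, neg_mul, Complex.I_mul_I, neg_neg, one_smul,
      add_sub_cancel, Matrix.smul_mul]
    simp only [Matrix.mul_assoc]

/-- The propagator in the rotating frame, built from the two series. -/
def propagator (ω : ℝ) (p q : ℕ) (t s : ℝ) : Matrix (Fin 2) (Fin 2) ℂ :=
  !![D.evenSeries ω p q t s, -D.oddSeries ω p q t s;
    conj (D.oddSeries ω p q t s), conj (D.evenSeries ω p q t s)]

theorem isTimeOrderedExp_propagator {ω : ℝ} {p q : ℕ} (hω : 0 < ω) (hp : 0 < p)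
    (hε : D.ωε = p * ω) (hΔ : D.ωΔ = q * ω) :
    IsTimeOrderedExp D.rotHamiltonian (D.propagator ω p q) := by
  have hω' : D.ωε ≠ 0 := by rw [hε]; positivity
  refine .of_hasEntryDerivAt_right (D.isHermitian_rotHamiltonian hω') (fun t => ?_) fun t s => ?_
  · rw [propagator, evenSeries_self, oddSeries_self]
    ext i j
    fin_cases i <;> fin_cases j <;> simp
  · have he := D.hasDerivAt_evenSeries hp hε hΔ t s
    have ho := D.hasDerivAt_oddSeries hp hε hΔ t s
    rw [D.rotHamiltonian_eq hω']
    intro i j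
    fin_cases i <;> fin_cases j
    · refine he.congr_deriv ?_
      simp [propagator]
      ring
    · refine ho.neg.congr_deriv ?_
      simp [propagator]
      ring
    · refine ho.star.congr_deriv ?_
      simp [propagator]
      ring
    · refine he.star.congr_deriv ?_
      simp [propagator]
      ring

/-- The frame is diagonal with entries of modulus one, so it changes only the phase of an entry. -/
theorem norm_frame_mul_mul_apply (U : Matrix (Fin 2) (Fin 2) ℂ) (t s : ℝ) :
    ‖(D.frame t * U * (D.frame s)ᴴ) 0 1‖ = ‖U 0 1‖ := by
  have h : ∀ (c x : ℝ), ‖Complex.exp (Complex.I * c * x)‖ = 1 := fun c x => by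
    rw [mul_assoc, ← Complex.ofReal_mul]; exact norm_cexp_I_mul_ofReal _
  have h1 := h (-(1 / 2)) (D.phase t)
  have h2 := h (1 / 2) (D.phase s)
  have e1 : Complex.I * ((-(1 / 2) : ℝ) : ℂ) = -(Complex.I / 2) := by push_cast; ring
  have e2 : Complex.I * ((1 / 2 : ℝ) : ℂ) = Complex.I / 2 := by push_cast; ring
  rw [e1] at h1
  rw [e2] at h2
  have : (D.frame t * U * (D.frame s)ᴴ) 0 1 = Complex.exp (-(Complex.I / 2) * D.phase t) * U 0 1 *
      conj (Complex.exp (Complex.I / 2 * D.phase s)) := by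
    simp [Matrix.mul_apply, Matrix.vecMul, dotProduct, Fin.sum_univ_two, frame]
  rw [this, norm_mul, norm_mul, h1, Complex.norm_conj, h2, one_mul, mul_one]

end Drive
end TwoLevel
end

theorem mainTheorem1 (D : TwoLevel.Drive) (ω : ℝ) (p q : ℕ) (hω : 0 < ω) (hp : 0 < p) (hq : 0 < q)
    (hε : D.ωε = p * ω) (hΔ : D.ωΔ = q * ω) :
    -- the rotating-frame Hamiltonian as a Fourier series with weighted Bessel coefficients
    (∀ t : ℝ,
      D.rotHamiltonian t 0 0 = 0 ∧ D.rotHamiltonian t 1 1 = 0 ∧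
      HasSum (fun l : ℤ => D.wbessel p q l * Complex.exp (Complex.I * (D.ε₀ + l * ω) * t))
        (D.rotHamiltonian t 0 1) ∧
      HasSum (fun l : ℤ => starRingEnd ℂ (D.wbessel p q l) *
          Complex.exp (-Complex.I * (D.ε₀ + l * ω) * t))
        (D.rotHamiltonian t 1 0)) ∧
    -- `V`, `U`: the time-ordered exponentials in the original and in the rotating frame
    ∃ V U : ℝ → ℝ → Matrix (Fin 2) (Fin 2) ℂ,
      (TwoLevel.IsTimeOrderedExp D.hamiltonian V ∧
        ∀ V', TwoLevel.IsTimeOrderedExp D.hamiltonian V' → V' = V) ∧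
      (TwoLevel.IsTimeOrderedExp D.rotHamiltonian U ∧
        ∀ U', TwoLevel.IsTimeOrderedExp D.rotHamiltonian U' → U' = U) ∧
      (∀ t s, V t s = D.frame t * U t s * (D.frame s).conjTranspose) ∧
      (∀ t s, U t s ∈ Matrix.unitaryGroup (Fin 2) ℂ) ∧
      -- the series for the entries of `U`
      (∀ t s, HasSum (fun i => D.term11 ω p q i t s) (U t s 0 0 - 1)) ∧
      (∀ t s, HasSum (fun i => D.term12 ω p q i t s) (-(U t s 0 1))) ∧
      (∀ t s, U t s 1 1 = starRingEnd ℂ (U t s 0 0)) ∧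
      (∀ t s, U t s 1 0 = -starRingEnd ℂ (U t s 0 1)) ∧
      -- uniform convergence on bounded ranges of `t - s`
      (∀ T : ℝ,
        HasSumUniformlyOn (fun i (x : ℝ × ℝ) => D.term11 ω p q i x.1 x.2)
          (fun x => U x.1 x.2 0 0 - 1) {x | |x.1 - x.2| ≤ T} ∧
        HasSumUniformlyOn (fun i (x : ℝ × ℝ) => D.term12 ω p q i x.1 x.2)
          (fun x => -(U x.1 x.2 0 1)) {x | |x.1 - x.2| ≤ T}) ∧
      -- the transition probability, the same in both frames
      (∀ t s, ‖V t s 0 1‖ ^ 2 = ‖∑' i, D.term12 ω p q i t s‖ ^ 2 ∧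
        ‖U t s 0 1‖ ^ 2 = ‖∑' i, D.term12 ω p q i t s‖ ^ 2) := by
  have hω' : D.ωε ≠ 0 := by rw [hε]; positivity
  have hU := D.isTimeOrderedExp_propagator hω hp hε hΔ
  have hV := D.isTimeOrderedExp_of_rot hω' hU
  have h11 : ∀ t s, D.propagator ω p q t s 0 0 - 1 = ∑' i, D.term11 ω p q i t s := fun t s => by
    simp [TwoLevel.Drive.propagator, TwoLevel.Drive.evenSeries]
  have h12 : ∀ t s, -(D.propagator ω p q t s 0 1) = ∑' i, D.term12 ω p q i t s := fun t s => by
    simp [TwoLevel.Drive.propagator, TwoLevel.Drive.oddSeries]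
  refine ⟨fun t => ?_, _, _,
    ⟨hV, fun V' hV' => hV.unique D.isHermitian_hamiltonian hV'⟩,
    ⟨hU, fun U' hU' => hU.unique (D.isHermitian_rotHamiltonian hω') hU'⟩, fun t s => rfl,
    hU.mem_unitaryGroup (D.isHermitian_rotHamiltonian hω'), fun t s => ?_, fun t s => ?_,
    fun t s => ?_, fun t s => ?_, fun T => ?_, fun t s => ?_⟩
  · rw [D.rotHamiltonian_eq hω']
    exact ⟨rfl, rfl, D.hasSum_coupling hp hε hΔ t, D.hasSum_conj_coupling hp hε hΔ t⟩
  · rw [h11]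
    exact (D.summable_norm_term11 ω q hp t s).of_norm.hasSum
  · rw [h12]
    exact (D.summable_norm_term12 ω q hp t s).of_norm.hasSum
  · simp [TwoLevel.Drive.propagator]
  · simp [TwoLevel.Drive.propagator]
  · simp only [h11, h12]
    -- The majorant needs a nonnegative radius, while `T` is arbitrary.
    have hle : ∀ x ∈ {x : ℝ × ℝ | |x.1 - x.2| ≤ T}, |x.1 - x.2| ≤ |T| :=
      fun x hx => le_trans hx (le_abs_self T)
    exact ⟨.of_norm_le_summable (D.summable_bound11 q hp (abs_nonneg T))
        fun i x hx => D.norm_term_le ω p q i.2.1 i.2.2 (hle x hx),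
      .of_norm_le_summable (D.summable_bound12 q hp (abs_nonneg T))
        fun i x hx => D.norm_term_le ω p q i.2.1 i.2.2 (hle x hx)⟩
  · rw [D.norm_frame_mul_mul_apply, ← h12, norm_neg]
    exact ⟨rfl, rfl⟩
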